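/- Let $N\ge 1$ and $0\le h\le\lfloor N/2\rfloor$ be integers, let $\varepsilon,\alpha,\rho\in\mathbb R$, $d_1,\dots,d_N,\xi_{1,0},\dots,\xi_{N,0}\in\mathbb R$ and $p_1,\dots,p_N,q_1,\dots,q_N\in\mathbb C$. Write $*$ for complex conjugation and $$\xi_i=p_i(x-6\varepsilon\rho^2t)+p_i^3t+\xi_{i,0},\qquad \eta_i=q_i(x-6\varepsilon\rho^2t)+q_i^3t+\xi_{i,0},$$ $$\tau_{k,l}(x,t)=\det\left(\delta_{ij}d_ie^{-\xi_i-\eta_j}+\frac1{p_i+q_j}\left(-\frac{p_i-\mathrm i\alpha}{q_j+\mathrm i\alpha}\right)^{k}\left(-\frac{p_i+\mathrm i\alpha}{q_j-\mathrm i\alpha}\right)^{l}\right)_{1\le i,j\le N},\qquad k,l\in\mathbb Z,$$ $$G(p,q)=\frac{\varepsilon\rho^2}{(p-\mathrm i\alpha)(q+\mathrm i\alpha)}+\frac{\varepsilon\rho^2}{(p+\mathrm i\alpha)(q-\mathrm i\alpha)}-1 .$$ Assume that no denominator vanishes, i.e. $p_i+q_j\ne0$ and $p_i,q_i\notin\{\mathrm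 i\alpha,-\mathrm i\alpha\}$ for all $i,j$, and that - $d_i=d_{N+1-i}$ and $\xi_{i,0}=\xi_{N+1-i,0}$ for $1\le i\le N$; - $p_i=p_{N+1-i}^*=q_i^*=q_{N+1-i}$ for $1\le i\le h$; - $p_i=q_{N+1-i}\in\mathbb R$ and $p_{N+1-i}=q_i\in\mathbb R$ for $h+1\le i\le\lceil N/2\rceil$; - $G(p_i,q_i)=0$ for $1\le i\le N$. Then the set $\Omega=\{(x,t)\in\mathbb R^2:\tau_{0,0}(x,t)\neq0\}$ is open, and the $N$-dark soliton $$u(x,t)=\rho\,\frac{\tau_{1,0}(x,t)}{\tau_{0,0}(x,t)}\,\exp\bigl(\mathrm i(\alpha x-(\alpha^3+6\varepsilon\alpha\rho^2)t)\bigr)$$ is a smooth solution on $\Omega$ of the Sasa–Satsuma equation $$u_t=u_{xxx}-6\varepsilon|u|^2u_x-3\varepsilon u\,(|u|^2)_x .$$ -/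

import Mathlib

open scoped ContDiff ComplexConjugate

noncomputable section

namespace SasaSatsuma

/-- `u = u(x, t)` is a smooth solution, on the open set `Ω` of the `(x, t)`-plane, of the
Sasa–Satsuma equation `u_t = u_xxx - 6 ε |u|² u_x - 3 ε u (|u|²)_x`. -/
def IsSolutionOn (ε : ℝ) (Ω : Set (ℝ × ℝ)) (u : ℝ → ℝ → ℂ) : Prop :=
  IsOpen Ω ∧ ContDiffOn ℝ ∞ (fun z : ℝ × ℝ => u z.1 z.2) Ω ∧
    ∀ x t : ℝ, (x, t) ∈ Ω →
      deriv (fun s : ℝ => u x s) t =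
        iteratedDeriv 3 (fun y : ℝ => u y t) x
          - 6 * (ε : ℂ) * ((‖u x t‖ ^ 2 : ℝ) : ℂ) * deriv (fun y : ℝ => u y t) x
          - 3 * (ε : ℂ) * u x t * ((deriv (fun y : ℝ => ‖u y t‖ ^ 2) x : ℝ) : ℂ)

/-- The phase `p (x - 6 ε ρ² t) + p³ t + c`; it is `ξ_i` for `p = p_i`, `c = ξ_{i,0}`, and `η_i`
for `p = q_i`, `c = ξ_{i,0}`. -/
def phase (ε ρ : ℝ) (p : ℂ) (c : ℝ) (x t : ℝ) : ℂ :=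
  p * ((x : ℂ) - 6 * (ε : ℂ) * (ρ : ℂ) ^ 2 * (t : ℂ)) + p ^ 3 * (t : ℂ) + (c : ℂ)

/-- The `N × N` determinant `τ_{k,l}(x, t)`. -/
def tau {N : ℕ} (ε α ρ : ℝ) (p q : Fin N → ℂ) (d ξ₀ : Fin N → ℝ) (k l : ℤ) (x t : ℝ) : ℂ :=
  Matrix.det (Matrix.of fun i j : Fin N =>
    (if i = j then (d i : ℂ) else 0)
        * Complex.exp (-phase ε ρ (p i) (ξ₀ i) x t - phase ε ρ (q j) (ξ₀ j) x t)
      + 1 / (p i + q j)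
        * (-((p i - Complex.I * α) / (q j + Complex.I * α))) ^ k
        * (-((p i + Complex.I * α) / (q j - Complex.I * α))) ^ l)

/-- The dispersion function `G(p, q)`. -/
def G (ε α ρ : ℝ) (p q : ℂ) : ℂ :=
  (ε : ℂ) * (ρ : ℂ) ^ 2 / ((p - Complex.I * α) * (q + Complex.I * α))
    + (ε : ℂ) * (ρ : ℂ) ^ 2 / ((p + Complex.I * α) * (q - Complex.I * α)) - 1

/-- The conditions on the parameters. The index `i ∈ {1, …, N}` is `(i : ℕ) + 1` for
`i : Fin N`, so that `N + 1 - i` is `Fin.rev i`. The first three fields say that no denominator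
in `tau` and `G` vanishes. -/
structure Admissible {N : ℕ} (h : ℕ) (ε α ρ : ℝ) (p q : Fin N → ℂ) (d ξ₀ : Fin N → ℝ) :
    Prop where
  add_ne_zero : ∀ i j, p i + q j ≠ 0
  p_ne : ∀ i, p i ≠ Complex.I * α ∧ p i ≠ -(Complex.I * α)
  q_ne : ∀ i, q i ≠ Complex.I * α ∧ q i ≠ -(Complex.I * α)
  d_symm : ∀ i, d i = d (Fin.rev i)
  ξ₀_symm : ∀ i, ξ₀ i = ξ₀ (Fin.rev i)
  conj_pair : ∀ i : Fin N, (i : ℕ) + 1 ≤ h →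
    p i = conj (p (Fin.rev i)) ∧ p i = conj (q i) ∧ p i = q (Fin.rev i)
  real_pair : ∀ i : Fin N, h + 1 ≤ (i : ℕ) + 1 → (i : ℕ) + 1 ≤ (N + 1) / 2 →
    p i = q (Fin.rev i) ∧ p (Fin.rev i) = q i ∧ (p i).im = 0 ∧ (p (Fin.rev i)).im = 0
  G_eq_zero : ∀ i, G ε α ρ (p i) (q i) = 0

/-- The dark soliton `u = ρ (g / f) exp (i (α x - (α³ + 6 ε α ρ²) t))` with `f = τ_{0,0}` and
`g = τ_{1,0}`. -/
def darkSoliton {N : ℕ} (ε α ρ : ℝ) (p q : Fin N → ℂ) (d ξ₀ : Fin N → ℝ) (x t : ℝ) : ℂ :=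
  (ρ : ℂ) * (tau ε α ρ p q d ξ₀ 1 0 x t / tau ε α ρ p q d ξ₀ 0 0 x t)
    * Complex.exp (Complex.I *
        ((α : ℂ) * x - ((α : ℂ) ^ 3 + 6 * (ε : ℂ) * (α : ℂ) * (ρ : ℂ) ^ 2) * (t : ℂ)))

end SasaSatsuma

end

open scoped ContDiff ComplexConjugate

noncomputable section

namespace SasaSatsuma

open Matrix

/-! ### The calculus of the pairing `Bᵀ M⁻¹ A` -/

section Pairing

variable {n : Type*} [Fintype n] [DecidableEq n]

/-! Write `⟨A, B⟩ = Bᵀ M⁻¹ A`, with `M` the matrix of `τ_{0,0}`, `μ = ερ²` and `a = iα`. Raising `k`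
from 0 to 1 is a rank-one change of `M`, so `v = τ_{1,0}/τ_{0,0} = 1 - ⟨1, 1/(q + a)⟩`
(`tau_one_zero`). The derivatives of `M` are `-(diagonal · M + M · diagonal)` plus a matrix of low
rank, so every derivative of a pairing is a quadratic polynomial in pairings (`hasDerivAt_pairing`),
and no bilinear tau identities are needed.

The parameter symmetries give `⟨f(p), 1⟩ = ⟨1, f(q)⟩` and `conj v = 1 - ⟨1, 1/(q - a)⟩`. With `S =
⟨1, 1⟩`, the symmetry under exchange of `p` and `q` alone yields the linear equation `v_t = v_xxx +
3a v_xx + 3a² v_x + 3 S_x (v_x + a v) - 6μ v_x + (3/2) S_xx v`. The condition `G = 0` supplies the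
potential, `S_x = 2μ(1 - |v|²)` (`Admissible.two_mul_pairing_p_one`). Substituting it and its
`x`-derivative gives a nonlinear equation for `v`, which multiplication by `ρ` and the plane wave
turns into Sasa–Satsuma. -/

/-- The bilinear pairing `Bᵀ M⁻¹ A`. -/
def pairing (M : Matrix n n ℂ) (A B : n → ℂ) : ℂ := B ⬝ᵥ (M⁻¹ *ᵥ A)

lemma pairing_add_left (M : Matrix n n ℂ) (A A' B : n → ℂ) :
    pairing M (A + A') B = pairing M A B + pairing M A' B := by
  simp [pairing, mulVec_add]

lemma pairing_sub_left (M : Matrix n n ℂ) (A A' B : n → ℂ) :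
    pairing M (A - A') B = pairing M A B - pairing M A' B := by
  simp [pairing, mulVec_sub]

lemma pairing_smul_left (M : Matrix n n ℂ) (c : ℂ) (A B : n → ℂ) :
    pairing M (c • A) B = c * pairing M A B := by
  simp [pairing, mulVec_smul]

lemma pairing_add_right (M : Matrix n n ℂ) (A B B' : n → ℂ) :
    pairing M A (B + B') = pairing M A B + pairing M A B' := by
  simp [pairing]

lemma pairing_sub_right (M : Matrix n n ℂ) (A B B' : n → ℂ) :
    pairing M A (B - B') = pairing M A B - pairing M A B' := by
  simp [pairing]

lemma pairing_smul_right (M : Matrix n n ℂ) (c : ℂ) (A B : n → ℂ) :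
    pairing M A (c • B) = c * pairing M A B := by
  simp [pairing]

lemma pairing_eq_sum (M : Matrix n n ℂ) (A B : n → ℂ) :
    pairing M A B = ∑ i, ∑ j, B i * M⁻¹ i j * A j := by
  simp [pairing, dotProduct, mulVec, Finset.mul_sum, mul_assoc]

/-- If `e` reverses `M` into its transpose, it exchanges the two arguments of the pairing. -/
lemma pairing_swap {M : Matrix n n ℂ} (e : n ≃ n) (hM : ∀ i j, M (e j) (e i) = M i j)
    (A B : n → ℂ) : pairing M (B ∘ e) (A ∘ e) = pairing M A B := by
  have h : Mᵀ.submatrix e e = M := by ext i j; simp [hM]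
  have h2 : ∀ i j, M⁻¹ i j = M⁻¹ (e j) (e i) := by
    intro i j
    conv_lhs => rw [← h, Matrix.inv_submatrix_equiv, ← Matrix.transpose_nonsing_inv]
    simp
  have h3 : ∑ i, ∑ j, (A ∘ e) i * M⁻¹ i j * (B ∘ e) j = ∑ i, ∑ j, A i * M⁻¹ j i * B j := by
    rw [← e.sum_comp fun i => ∑ j, A i * M⁻¹ j i * B j]
    refine Finset.sum_congr rfl fun i _ => ?_
    rw [← e.sum_comp fun j => A (e i) * M⁻¹ j (e i) * B j]
    exact Finset.sum_congr rfl fun j _ => by rw [h2 i j]; rfl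
  rw [pairing_eq_sum, pairing_eq_sum, h3, Finset.sum_comm]
  exact Finset.sum_congr rfl fun i _ => Finset.sum_congr rfl fun j _ => by ring

/-- If `e` conjugates `M`, the pairing is conjugated along `e`. -/
lemma conj_pairing {M : Matrix n n ℂ} (e : n ≃ n) (hM : ∀ i j, M (e i) (e j) = conj (M i j))
    (A B : n → ℂ) :
    conj (pairing M A B) =
      pairing M (fun i => conj (A (e.symm i))) (fun i => conj (B (e.symm i))) := by
  have h : M.submatrix e e = M.map (starRingEnd ℂ) := by ext i j; simp [hM]
  have h2 : ∀ i j, conj (M⁻¹ i j) = M⁻¹ (e i) (e j) := by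
    intro i j
    have h3 : (M.map (starRingEnd ℂ))⁻¹ = (M⁻¹).map (starRingEnd ℂ) := by
      have h4 : ∀ K : Matrix n n ℂ, K.map (starRingEnd ℂ) = Kᴴᵀ := fun K => rfl
      rw [h4, h4, ← Matrix.transpose_nonsing_inv, Matrix.conjTranspose_nonsing_inv]
    rw [← h, Matrix.inv_submatrix_equiv] at h3
    exact (congr_fun₂ h3 i j).symm
  rw [pairing_eq_sum, pairing_eq_sum]
  simp only [map_sum, map_mul, h2]
  rw [← e.sum_comp fun i => ∑ j, conj (B (e.symm i)) * M⁻¹ i j * conj (A (e.symm j))]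
  refine Finset.sum_congr rfl fun i _ => ?_
  rw [← e.sum_comp fun j => conj (B (e.symm (e i))) * M⁻¹ (e i) j * conj (A (e.symm j))]
  simp

/-- A Sylvester equation for `M` turned into a relation between values of the pairing. -/
lemma pairing_sylvester {M : Matrix n n ℂ} (hdet : M.det ≠ 0) {ι : Type*} [Fintype ι]
    (a b : n → ℂ) (r c : ι → n → ℂ) (K : Matrix n n ℂ)
    (hK : ∀ i j, K i j = ∑ k, r k i * c k j - a i * M i j - M i j * b j) (A B : n → ℂ) :
    -(B ⬝ᵥ ((M⁻¹ * K * M⁻¹) *ᵥ A)) = pairing M (a * A) B + pairing M A (b * B)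
      - ∑ k, pairing M A (c k) * pairing M (r k) B := by
  have hu : IsUnit M.det := isUnit_iff_ne_zero.2 hdet
  have hK' : K = ∑ k, vecMulVec (r k) (c k) - diagonal a * M - M * diagonal b := by
    ext i j
    simp [hK, Matrix.sum_apply, vecMulVec_apply]
  have h1 : M⁻¹ * K * M⁻¹ = ∑ k, M⁻¹ * vecMulVec (r k) (c k) * M⁻¹
      - M⁻¹ * diagonal a - diagonal b * M⁻¹ := by
    rw [hK', Matrix.mul_sub, Matrix.mul_sub, Matrix.sub_mul, Matrix.sub_mul, Matrix.mul_sum,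
      Matrix.sum_mul, Matrix.mul_assoc M⁻¹ (diagonal a * M), Matrix.mul_assoc (diagonal a),
      Matrix.mul_nonsing_inv M hu, Matrix.mul_one, ← Matrix.mul_assoc M⁻¹ M,
      Matrix.nonsing_inv_mul M hu, Matrix.one_mul]
  have h2 : ∀ k, B ⬝ᵥ ((M⁻¹ * vecMulVec (r k) (c k) * M⁻¹) *ᵥ A)
      = pairing M A (c k) * pairing M (r k) B := by
    intro k
    rw [← mulVec_mulVec, ← mulVec_mulVec, vecMulVec_mulVec]
    simp [pairing, mulVec_smul]
  have h3 : diagonal a *ᵥ A = a * A := by ext i; simp [mulVec_diagonal]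
  have h4 : ∀ w : n → ℂ, B ⬝ᵥ (diagonal b *ᵥ w) = (b * B) ⬝ᵥ w := by
    intro w
    simp only [dotProduct, mulVec_diagonal, Pi.mul_apply]
    exact Finset.sum_congr rfl fun i _ => by ring
  rw [h1, sub_mulVec, sub_mulVec, sum_mulVec, dotProduct_sub, dotProduct_sub, dotProduct_sum,
    ← mulVec_mulVec, ← mulVec_mulVec, h3, h4]
  simp only [h2, pairing]
  ring

lemma hasDerivAt_inv_entry {M : ℝ → Matrix n n ℂ} {M' : Matrix n n ℂ} {x : ℝ}
    (hM : ∀ i j, HasDerivAt (fun s => M s i j) (M' i j) x) (hdet : (M x).det ≠ 0) (i j : n) :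
    HasDerivAt (fun s => (M s)⁻¹ i j) (-((M x)⁻¹ * M' * (M x)⁻¹) i j) x := by
  -- The statement is entrywise, so any submultiplicative norm serves to differentiate the ring
  -- inverse.
  let _ : NormedRing (Matrix n n ℂ) := Matrix.linftyOpNormedRing
  let _ : NormedAlgebra ℝ (Matrix n n ℂ) := Matrix.linftyOpNormedAlgebra
  obtain ⟨w, hw⟩ : IsUnit (M x) := (Matrix.isUnit_iff_isUnit_det _).2 (isUnit_iff_ne_zero.2 hdet)
  have h0 : HasDerivAt M M' x := by
    refine hasDerivAt_pi.2 fun i => hasDerivAt_pi.2 fun j => hM i j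
  have h1 := hasFDerivAt_ringInverse (𝕜 := ℝ) w
  rw [hw] at h1
  have h2 := h1.comp_hasDerivAt x h0
  have h3 := hasDerivAt_pi.1 (hasDerivAt_pi.1 h2 i) j
  refine (h3.congr_deriv ?_).congr_of_eventuallyEq (Filter.Eventually.of_forall fun s => ?_)
  · have h4 : ((w⁻¹ : (Matrix n n ℂ)ˣ) : Matrix n n ℂ) = (M x)⁻¹ := by
      rw [Matrix.coe_units_inv, hw]
    simp [h4]
  · simp [Matrix.nonsing_inv_eq_ringInverse]

lemma hasDerivAt_pairing {M : ℝ → Matrix n n ℂ} {x : ℝ} (hdet : (M x).det ≠ 0)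
    {ι : Type*} [Fintype ι] (a b : n → ℂ) (r c : ι → n → ℂ)
    (hM : ∀ i j, HasDerivAt (fun s => M s i j)
      (∑ k, r k i * c k j - a i * M x i j - M x i j * b j) x) (A B : n → ℂ) :
    HasDerivAt (fun s => pairing (M s) A B)
      (pairing (M x) (a * A) B + pairing (M x) A (b * B)
        - ∑ k, pairing (M x) A (c k) * pairing (M x) (r k) B) x := by
  rw [← pairing_sylvester hdet a b r c
    (of fun i j => ∑ k, r k i * c k j - a i * M x i j - M x i j * b j) (fun i j => rfl)]
  have h := hasDerivAt_inv_entry (M' := of fun i j =>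
    ∑ k, r k i * c k j - a i * M x i j - M x i j * b j) hM hdet
  simp only [pairing_eq_sum]
  refine (HasDerivAt.fun_sum fun i _ => HasDerivAt.fun_sum fun j _ =>
    ((h i j).const_mul (B i)).mul_const (A j)).congr_deriv ?_
  simp only [dotProduct, mulVec, Finset.mul_sum, ← Finset.sum_neg_distrib]
  exact Finset.sum_congr rfl fun i _ => Finset.sum_congr rfl fun j _ => by ring

lemma det_sub_vecMulVec {M : Matrix n n ℂ} (hdet : M.det ≠ 0) (A B : n → ℂ) :
    (M - vecMulVec A B).det = M.det * (1 - pairing M A B) := by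
  have hu : IsUnit M.det := isUnit_iff_ne_zero.2 hdet
  have h := Matrix.det_add_replicateCol_mul_replicateRow (ι := Unit) hu (-A) B
  rw [show M - vecMulVec A B = M + replicateCol Unit (-A) * replicateRow Unit B by
    ext i j; simp [vecMulVec_apply, Matrix.mul_apply, sub_eq_add_neg], h]
  congr 1
  rw [Matrix.det_unique]
  simp only [pairing_eq_sum, Matrix.add_apply, Matrix.mul_apply, Matrix.one_apply_eq,
    replicateRow_apply, replicateCol_apply, Finset.sum_mul, Pi.neg_apply, mul_neg,
    Finset.sum_neg_distrib, sub_eq_add_neg]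
  rw [Finset.sum_comm]

end Pairing

/-! ### The soliton matrix and its flows -/

section Soliton

variable {N : ℕ}

/-- The matrix whose determinant is `τ_{0,0}`. -/
def solitonMatrix (ε ρ : ℝ) (p q : Fin N → ℂ) (d ξ₀ : Fin N → ℝ) (x t : ℝ) :
    Matrix (Fin N) (Fin N) ℂ :=
  of fun i j => (if i = j then (d i : ℂ) else 0)
    * Complex.exp (-phase ε ρ (p i) (ξ₀ i) x t - phase ε ρ (q j) (ξ₀ j) x t) + 1 / (p i + q j)

variable {ε α ρ : ℝ} {p q : Fin N → ℂ} {d ξ₀ : Fin N → ℝ}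

lemma tau_zero_zero (x t : ℝ) :
    tau ε α ρ p q d ξ₀ 0 0 x t = (solitonMatrix ε ρ p q d ξ₀ x t).det := by
  simp [tau, solitonMatrix]

/-- The vector `1 / (q + i α)`. -/
def pole (α : ℝ) (q : Fin N → ℂ) (i : Fin N) : ℂ := 1 / (q i + Complex.I * α)

/-- The Cauchy entry changes by `-(p - iα) / ((p + q)(q + iα)) = 1/(p + q) - 1/(q + iα)`; the matrix
determinant lemma does the rest. -/
lemma tau_one_zero {x t : ℝ} (hpq : ∀ i j, p i + q j ≠ 0)
    (hq : ∀ i, q i ≠ -(Complex.I * α)) (hdet : (solitonMatrix ε ρ p q d ξ₀ x t).det ≠ 0) :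
    tau ε α ρ p q d ξ₀ 1 0 x t / tau ε α ρ p q d ξ₀ 0 0 x t
      = 1 - pairing (solitonMatrix ε ρ p q d ξ₀ x t) 1 (pole α q) := by
  have h : tau ε α ρ p q d ξ₀ 1 0 x t
      = (solitonMatrix ε ρ p q d ξ₀ x t - vecMulVec 1 (pole α q)).det := by
    unfold tau
    congr 1
    ext i j
    have h1 := hpq i j
    have h2 : q j + Complex.I * α ≠ 0 := fun h => hq j (eq_neg_of_add_eq_zero_left h)
    simp only [solitonMatrix, pole, of_apply, Matrix.sub_apply, vecMulVec_apply, zpow_one,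
      zpow_zero, Pi.one_apply, mul_one, one_mul]
    field_simp
    ring
  rw [h, det_sub_vecMulVec hdet, tau_zero_zero, mul_div_cancel_left₀ _ hdet]

lemma hasDerivAt_phase_x (c : ℝ) (z : ℂ) (x t : ℝ) :
    HasDerivAt (fun y => phase ε ρ z c y t) z x := by
  have h : HasDerivAt (fun y : ℝ => (y : ℂ)) 1 x := Complex.ofRealCLM.hasDerivAt
  unfold phase
  simpa using (((h.sub_const _).const_mul z).add_const (z ^ 3 * (t : ℂ))).add_const (c : ℂ)

lemma hasDerivAt_phase_t (c : ℝ) (z : ℂ) (x t : ℝ) :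
    HasDerivAt (fun s => phase ε ρ z c x s) (z ^ 3 - 6 * (ε * (ρ : ℂ) ^ 2) * z) t := by
  have h : HasDerivAt (fun y : ℝ => (y : ℂ)) 1 t := Complex.ofRealCLM.hasDerivAt
  unfold phase
  refine ((((h.const_mul (6 * (ε : ℂ) * (ρ : ℂ) ^ 2)).const_sub (x : ℂ)).const_mul z).add
    (h.const_mul (z ^ 3))).add_const (c : ℂ) |>.congr_deriv ?_
  ring

/-- Since `(p + q) · 1/(p + q) = 1`, the Cauchy part leaves a rank-one source. -/
lemma hasDerivAt_pairing_x (hpq : ∀ i j, p i + q j ≠ 0) {x t : ℝ}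
    (hdet : (solitonMatrix ε ρ p q d ξ₀ x t).det ≠ 0) (A B : Fin N → ℂ) :
    HasDerivAt (fun y => pairing (solitonMatrix ε ρ p q d ξ₀ y t) A B)
      (pairing (solitonMatrix ε ρ p q d ξ₀ x t) (p * A) B
        + pairing (solitonMatrix ε ρ p q d ξ₀ x t) A (q * B)
        - pairing (solitonMatrix ε ρ p q d ξ₀ x t) A 1
          * pairing (solitonMatrix ε ρ p q d ξ₀ x t) 1 B) x := by
  have h := hasDerivAt_pairing (ι := Unit) (M := fun y => solitonMatrix ε ρ p q d ξ₀ y t) hdet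
    p q (fun _ => 1) (fun _ => 1) (fun i j => ?_) A B
  · simpa using h
  · have h1 := hpq i j
    simp only [solitonMatrix, of_apply]
    refine ((((hasDerivAt_phase_x (ξ₀ i) (p i) x t).neg.sub
      (hasDerivAt_phase_x (ξ₀ j) (q j) x t)).cexp.const_mul _).add_const _).congr_deriv ?_
    generalize (if i = j then (d i : ℂ) else 0) = D
    simp
    field_simp
    ring

lemma hasDerivAt_pairing_t (hpq : ∀ i j, p i + q j ≠ 0) {x t : ℝ}
    (hdet : (solitonMatrix ε ρ p q d ξ₀ x t).det ≠ 0) (A B : Fin N → ℂ) :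
    HasDerivAt (fun s => pairing (solitonMatrix ε ρ p q d ξ₀ x s) A B)
      (pairing (solitonMatrix ε ρ p q d ξ₀ x t) (p ^ 3 * A) B
        + pairing (solitonMatrix ε ρ p q d ξ₀ x t) A (q ^ 3 * B)
        - (pairing (solitonMatrix ε ρ p q d ξ₀ x t) A 1
            * pairing (solitonMatrix ε ρ p q d ξ₀ x t) (p ^ 2) B
          - pairing (solitonMatrix ε ρ p q d ξ₀ x t) A q
            * pairing (solitonMatrix ε ρ p q d ξ₀ x t) p B
          + pairing (solitonMatrix ε ρ p q d ξ₀ x t) A (q ^ 2)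
            * pairing (solitonMatrix ε ρ p q d ξ₀ x t) 1 B)
        - 6 * (ε * (ρ : ℂ) ^ 2) * (pairing (solitonMatrix ε ρ p q d ξ₀ x t) (p * A) B
        + pairing (solitonMatrix ε ρ p q d ξ₀ x t) A (q * B)
        - pairing (solitonMatrix ε ρ p q d ξ₀ x t) A 1
          * pairing (solitonMatrix ε ρ p q d ξ₀ x t) 1 B)) t := by
  have h := hasDerivAt_pairing (ι := Fin 4) (M := fun s => solitonMatrix ε ρ p q d ξ₀ x s) hdet
    (p ^ 3 - (6 * (ε * (ρ : ℂ) ^ 2)) • p) (q ^ 3 - (6 * (ε * (ρ : ℂ) ^ 2)) • q)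
    -- The first three pairs encode `(p³ + q³)/(p + q) = p² - pq + q²`; the fourth is the source of
    -- the `x`-flow, scaled by `-6μ`.
    ![p ^ 2, (-1 : ℂ) • p, 1, (-(6 * (ε * (ρ : ℂ) ^ 2))) • 1] ![1, q, q ^ 2, 1]
    (fun i j => ?_) A B
  · refine h.congr_deriv ?_
    simp only [Fin.sum_univ_four, sub_mul, smul_mul_assoc, pairing_sub_left, pairing_smul_left,
      pairing_sub_right, pairing_smul_right, Matrix.cons_val]
    ring
  · have h1 := hpq i j
    simp only [solitonMatrix, of_apply]
    refine ((((hasDerivAt_phase_t (ξ₀ i) (p i) x t).neg.sub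
      (hasDerivAt_phase_t (ξ₀ j) (q j) x t)).cexp.const_mul _).add_const _).congr_deriv ?_
    generalize (if i = j then (d i : ℂ) else 0) = D
    simp [Fin.sum_univ_four]
    field_simp
    ring

end Soliton

/-! ### Symmetries of the parameters and the reduction `G = 0` -/

section Reduction

variable {N h : ℕ} {ε α ρ : ℝ} {p q : Fin N → ℂ} {d ξ₀ : Fin N → ℝ}

lemma Admissible.p_eq_q_rev (H : Admissible h ε α ρ p q d ξ₀) (i : Fin N) :
    p i = q (Fin.rev i) := by
  have key : ∀ i : Fin N, (i : ℕ) + 1 ≤ (N + 1) / 2 → p i = q i.rev ∧ p i.rev = q i := by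
    intro i hi
    by_cases h1 : (i : ℕ) + 1 ≤ h
    · obtain ⟨h2, h3, h4⟩ := H.conj_pair i h1
      refine ⟨h4, ?_⟩
      rw [← Complex.conj_conj (p i.rev), ← h2, h3, Complex.conj_conj]
    · obtain ⟨h2, h3, -, -⟩ := H.real_pair i (by omega) hi
      exact ⟨h2, h3⟩
  by_cases h1 : (i : ℕ) + 1 ≤ (N + 1) / 2
  · exact (key i h1).1
  · have h2 := (key i.rev (by rw [Fin.val_rev]; omega)).2
    rwa [Fin.rev_rev] at h2

/-- Complex conjugation permutes the parameters. -/
lemma Admissible.exists_conj_perm (H : Admissible h ε α ρ p q d ξ₀) :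
    ∃ e : Equiv.Perm (Fin N), (∀ i, p (e i) = conj (p i)) ∧ (∀ i, q (e i) = conj (q i)) ∧
      (∀ i, d (e i) = d i) ∧ ∀ i, ξ₀ (e i) = ξ₀ i := by
  -- Reversal on the `h` outer pairs, where reversed parameters are conjugate; identity on the
  -- middle block, where they are real. It commutes with `Fin.rev`, so the claim for `q` follows
  -- from that for `p`.
  let π : Fin N → Fin N := fun i => if (i : ℕ) + 1 ≤ h ∨ (i.rev : ℕ) + 1 ≤ h then i.rev else i
  have hπ : Function.Involutive π := by
    intro i
    by_cases h1 : (i : ℕ) + 1 ≤ h ∨ (i.rev : ℕ) + 1 ≤ h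
    · have h2 : (i.rev : ℕ) + 1 ≤ h ∨ (i.rev.rev : ℕ) + 1 ≤ h := by
        rw [Fin.rev_rev]; exact h1.symm
      simp only [π, if_pos h1, if_pos h2, Fin.rev_rev]
    · simp only [π, if_neg h1]
  have hp : ∀ i, p (π i) = conj (p i) := by
    intro i
    by_cases h1 : (i : ℕ) + 1 ≤ h ∨ (i.rev : ℕ) + 1 ≤ h
    · simp only [π, if_pos h1]
      rcases h1 with h1 | h1
      · rw [(H.conj_pair i h1).1, Complex.conj_conj]
      · have h2 := (H.conj_pair i.rev h1).1
        rwa [Fin.rev_rev] at h2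
    · simp only [π, if_neg h1]
      rw [not_or] at h1
      symm
      rw [Complex.conj_eq_iff_im]
      by_cases h2 : (i : ℕ) + 1 ≤ (N + 1) / 2
      · exact (H.real_pair i (by omega) h2).2.2.1
      · have h3 := (H.real_pair i.rev (by omega) (by rw [Fin.val_rev]; omega)).2.2.2
        rwa [Fin.rev_rev] at h3
  have hπr : ∀ i, π i.rev = (π i).rev := by
    intro i
    by_cases h1 : (i : ℕ) + 1 ≤ h ∨ (i.rev : ℕ) + 1 ≤ h
    · have h2 : (i.rev : ℕ) + 1 ≤ h ∨ (i.rev.rev : ℕ) + 1 ≤ h := by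
        rw [Fin.rev_rev]; exact h1.symm
      simp only [π, if_pos h1, if_pos h2]
    · have h2 : ¬((i.rev : ℕ) + 1 ≤ h ∨ (i.rev.rev : ℕ) + 1 ≤ h) := by
        rw [Fin.rev_rev]; exact fun h3 => h1 h3.symm
      simp only [π, if_neg h1, if_neg h2]
  have hpq := H.p_eq_q_rev
  have hq : ∀ i, q i = p i.rev := fun i => by rw [hpq, Fin.rev_rev]
  refine ⟨hπ.toPerm, hp, fun i => ?_, fun i => ?_, fun i => ?_⟩
  · rw [Function.Involutive.coe_toPerm, hq, ← hπr, hp, ← hq]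
  · rw [Function.Involutive.coe_toPerm]
    by_cases h1 : (i : ℕ) + 1 ≤ h ∨ (i.rev : ℕ) + 1 ≤ h
    · simp only [π, if_pos h1]; exact (H.d_symm i).symm
    · simp only [π, if_neg h1]
  · rw [Function.Involutive.coe_toPerm]
    by_cases h1 : (i : ℕ) + 1 ≤ h ∨ (i.rev : ℕ) + 1 ≤ h
    · simp only [π, if_pos h1]; exact (H.ξ₀_symm i).symm
    · simp only [π, if_neg h1]

/-- Reversal exchanges `p` and `q` and fixes `d` and `ξ₀`, hence sends `M` to its transpose. -/
lemma Admissible.pairing_symm (H : Admissible h ε α ρ p q d ξ₀) (x t : ℝ)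
    (A B : Fin N → ℂ) :
    pairing (solitonMatrix ε ρ p q d ξ₀ x t) (B ∘ Fin.rev) (A ∘ Fin.rev)
      = pairing (solitonMatrix ε ρ p q d ξ₀ x t) A B := by
  have hpq := H.p_eq_q_rev
  have hq : ∀ i, q i = p i.rev := fun i => by rw [hpq, Fin.rev_rev]
  refine pairing_swap Fin.revPerm (fun i j => ?_) A B
  simp only [solitonMatrix, of_apply, Fin.revPerm_apply, ← hpq, ← hq, ← H.ξ₀_symm, ← H.d_symm,
    Fin.rev_inj]
  rw [add_comm (q j)]
  congr 2
  · by_cases h1 : i = j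
    · simp [h1]
    · simp [h1, Ne.symm h1]
  · congr 1
    ring

lemma Admissible.pairing_p_one (H : Admissible h ε α ρ p q d ξ₀) (x t : ℝ)
    (f : ℂ → ℂ) :
    pairing (solitonMatrix ε ρ p q d ξ₀ x t) (f ∘ p) 1
      = pairing (solitonMatrix ε ρ p q d ξ₀ x t) 1 (f ∘ q) := by
  rw [← H.pairing_symm x t 1 (f ∘ q)]
  congr 1
  ext i
  simp [H.p_eq_q_rev]

lemma Admissible.conj_pairing_pole (H : Admissible h ε α ρ p q d ξ₀)
    (x t : ℝ) :
    conj (pairing (solitonMatrix ε ρ p q d ξ₀ x t) 1 (pole α q))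
      = pairing (solitonMatrix ε ρ p q d ξ₀ x t) 1 (pole (-α) q) := by
  obtain ⟨e, hp, hq, hd, hξ⟩ := H.exists_conj_perm
  rw [conj_pairing e]
  · congr 1
    · ext i; simp
    · ext i
      have h1 := hq (e.symm i)
      rw [e.apply_symm_apply] at h1
      simp [pole, h1]
  · intro i j
    simp only [solitonMatrix, of_apply, e.injective.eq_iff, hp, hq, hd, hξ, map_add, map_mul,
      map_div₀, ← Complex.exp_conj, phase, map_sub, map_neg, map_pow, Complex.conj_ofReal, map_one]
    congr 2
    · by_cases h1 : i = j <;> simp [h1]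
    · simp [Complex.conj_ofNat]

/-- The reduction `G(p_i, q_i) = 0` in terms of the pairing. -/
lemma Admissible.two_mul_pairing_p_one (H : Admissible h ε α ρ p q d ξ₀)
    {x t : ℝ} (hdet : (solitonMatrix ε ρ p q d ξ₀ x t).det ≠ 0) :
    2 * pairing (solitonMatrix ε ρ p q d ξ₀ x t) p 1
        - pairing (solitonMatrix ε ρ p q d ξ₀ x t) 1 1 ^ 2
      = 2 * (ε * (ρ : ℂ) ^ 2) * (1 - (1 - pairing (solitonMatrix ε ρ p q d ξ₀ x t) 1 (pole α q))
        * (1 - pairing (solitonMatrix ε ρ p q d ξ₀ x t) 1 (pole (-α) q))) := by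
  set M := solitonMatrix ε ρ p q d ξ₀ x t with hM
  set μ : ℂ := ε * (ρ : ℂ) ^ 2 with hμ
  -- A Sylvester relation with zero left side: the flow with these rates fixes `M`. Note that `pole
  -- (-α) p` is `1/(p - iα)`.
  have h1 := pairing_sylvester hdet (μ • (pole (-α) p + pole α p) - p)
    (μ • (pole (-α) q + pole α q) - q)
    ![μ • pole (-α) p, μ • pole α p, (-1 : ℂ) • 1] ![pole α q, pole (-α) q, 1] 0 (fun i j => ?_) 1 1
  · have e1 := H.pairing_p_one x t id
    have e2 := H.pairing_p_one x t fun z => 1 / (z + Complex.I * α)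
    have e3 := H.pairing_p_one x t fun z => 1 / (z + Complex.I * (-α : ℝ))
    change pairing M p 1 = pairing M 1 q at e1
    change pairing M (pole α p) 1 = pairing M 1 (pole α q) at e2
    change pairing M (pole (-α) p) 1 = pairing M 1 (pole (-α) q) at e3
    simp only [Matrix.mul_zero, Matrix.zero_mul, zero_mulVec, dotProduct_zero, neg_zero, mul_one,
      Fin.sum_univ_three, pairing_sub_left, pairing_smul_left, pairing_add_left,
      pairing_sub_right, pairing_smul_right, pairing_add_right, Matrix.cons_val, e2, e3] at h1
    rw [e1] at h1 ⊢
    linear_combination h1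
  · have a1 := H.add_ne_zero i j
    have a2 : p i + Complex.I * α ≠ 0 := fun h => (H.p_ne i).2 (eq_neg_of_add_eq_zero_left h)
    have a3 : p i + Complex.I * (-α) ≠ 0 := fun h => (H.p_ne i).1 (by linear_combination h)
    have a4 : q j + Complex.I * α ≠ 0 := fun h => (H.q_ne j).2 (eq_neg_of_add_eq_zero_left h)
    have a5 : q j + Complex.I * (-α) ≠ 0 := fun h => (H.q_ne j).1 (by linear_combination h)
    simp only [hM, solitonMatrix, of_apply, Matrix.zero_apply, Fin.sum_univ_three,
      Matrix.cons_val, Pi.smul_apply, Pi.add_apply, Pi.sub_apply, Pi.one_apply, smul_eq_mul,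
      pole, Complex.ofReal_neg]
    have b3 : p i - Complex.I * α ≠ 0 := fun h => (H.p_ne i).1 (by linear_combination h)
    have b5 : q j - Complex.I * α ≠ 0 := fun h => (H.q_ne j).1 (by linear_combination h)
    -- Partial fractions settle the Cauchy part for all `i, j`. The exponential part lives on the
    -- diagonal, where its rate is `(p i + q i) · G = 0`.
    have hC : μ * (1 / (p i - Complex.I * α)) * (1 / (q j + Complex.I * α)) +
        μ * (1 / (p i + Complex.I * α)) * (1 / (q j - Complex.I * α)) + -1 * 1 * 1
        = (μ * (1 / (p i - Complex.I * α) + 1 / (p i + Complex.I * α)) - p i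
        + (μ * (1 / (q j - Complex.I * α) + 1 / (q j + Complex.I * α)) - q j))
          * (1 / (p i + q j)) := by
      field_simp
      ring
    simp only [mul_neg, ← sub_eq_add_neg]
    by_cases hij : i = j
    · subst hij
      have hG := H.G_eq_zero i
      rw [G, ← hμ] at hG
      have hG' : μ * (1 / (p i - Complex.I * α) + 1 / (p i + Complex.I * α)) - p i
          + (μ * (1 / (q i - Complex.I * α) + 1 / (q i + Complex.I * α)) - q i) = 0 := by
        refine Eq.trans ?_ ((congrArg (fun z => (p i + q i) * z) hG).trans (mul_zero _))
        field_simp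
        ring
      simp only [if_true]
      generalize (d i : ℂ) * Complex.exp _ = D
      linear_combination D * hG' - hC
    · simp only [if_neg hij]
      linear_combination -hC

end Reduction

lemma iteratedDeriv_three_of_hasDerivAt {U : Set ℝ} (hU : IsOpen U) {f f₁ f₂ f₃ : ℝ → ℂ}
    (h₁ : ∀ y ∈ U, HasDerivAt f (f₁ y) y) (h₂ : ∀ y ∈ U, HasDerivAt f₁ (f₂ y) y)
    (h₃ : ∀ y ∈ U, HasDerivAt f₂ (f₃ y) y) {x : ℝ} (hx : x ∈ U) :
    iteratedDeriv 3 f x = f₃ x := by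
  have key : ∀ {g g' : ℝ → ℂ}, (∀ y ∈ U, HasDerivAt g (g' y) y) → ∀ y ∈ U, deriv g =ᶠ[nhds y] g' :=
    fun hg y hy => Filter.eventually_of_mem (hU.mem_nhds hy) fun z hz => (hg z hz).deriv
  rw [iteratedDeriv_succ, iteratedDeriv_succ, iteratedDeriv_one]
  have h4 : ∀ y ∈ U, HasDerivAt (deriv f) (f₂ y) y :=
    fun y hy => (h₂ y hy).congr_of_eventuallyEq (key h₁ y hy)
  have h5 : HasDerivAt (deriv (deriv f)) (f₃ x) x :=
    (h₃ x hx).congr_of_eventuallyEq (key h4 x hx)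
  exact h5.deriv

/-! ### The evolution equation of the amplitude -/

section Soliton

variable {N h : ℕ} {ε α ρ : ℝ} {p q : Fin N → ℂ} {d ξ₀ : Fin N → ℝ}

/-- The quotient `τ_{1,0} / τ_{0,0}` expressed through the pairing. -/
def amplitude (ε α ρ : ℝ) (p q : Fin N → ℂ) (d ξ₀ : Fin N → ℝ) (x t : ℝ) : ℂ :=
  1 - pairing (solitonMatrix ε ρ p q d ξ₀ x t) 1 (pole α q)

lemma contDiff_tau (k l : ℤ) :
    ContDiff ℝ ∞ fun z : ℝ × ℝ => tau ε α ρ p q d ξ₀ k l z.1 z.2 := by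
  have h1 : ContDiff ℝ ∞ fun z : ℝ × ℝ => (z.1 : ℂ) := Complex.ofRealCLM.contDiff.comp contDiff_fst
  have h2 : ContDiff ℝ ∞ fun z : ℝ × ℝ => (z.2 : ℂ) := Complex.ofRealCLM.contDiff.comp contDiff_snd
  simp only [tau, Matrix.det_apply, of_apply, phase]
  refine ContDiff.sum fun σ _ => ContDiff.const_smul _ (contDiff_prod fun i _ => ?_)
  fun_prop

/-- The amplitude satisfies the gauge transformed Sasa–Satsuma equation. -/
lemma Admissible.amplitude_hasDerivAt (H : Admissible h ε α ρ p q d ξ₀) (t : ℝ)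
    {U : Set ℝ} (hU : IsOpen U)
    (hdet : ∀ y ∈ U, (solitonMatrix ε ρ p q d ξ₀ y t).det ≠ 0) :
    ∃ v₁ v₂ v₃ : ℝ → ℂ,
      (∀ y ∈ U, HasDerivAt (fun y => amplitude ε α ρ p q d ξ₀ y t) (v₁ y) y) ∧
      (∀ y ∈ U, HasDerivAt v₁ (v₂ y) y) ∧ (∀ y ∈ U, HasDerivAt v₂ (v₃ y) y) ∧
      ∀ y ∈ U, HasDerivAt (fun s => amplitude ε α ρ p q d ξ₀ y s)
        (v₃ y + 3 * (Complex.I * α) * v₂ y + 3 * (Complex.I * α) ^ 2 * v₁ y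
          - 6 * (ε * (ρ : ℂ) ^ 2) * (amplitude ε α ρ p q d ξ₀ y t
            * conj (amplitude ε α ρ p q d ξ₀ y t))
              * (v₁ y + Complex.I * α * amplitude ε α ρ p q d ξ₀ y t)
          + 6 * (ε * (ρ : ℂ) ^ 2) * (Complex.I * α) * amplitude ε α ρ p q d ξ₀ y t
          - 3 * (ε * (ρ : ℂ) ^ 2) * amplitude ε α ρ p q d ξ₀ y t
            * (v₁ y * conj (amplitude ε α ρ p q d ξ₀ y t)
              + amplitude ε α ρ p q d ξ₀ y t * conj (v₁ y))) t := by
  set μ : ℂ := ε * (ρ : ℂ) ^ 2 with hμ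
  set a : ℂ := Complex.I * α with ha
  set M : ℝ → Matrix (Fin N) (Fin N) ℂ := fun y => solitonMatrix ε ρ p q d ξ₀ y t with hM
  set b := pole α q with hb
  set v : ℝ → ℂ := fun y => amplitude ε α ρ p q d ξ₀ y t with hv
  have hX : ∀ y ∈ U, ∀ A B, HasDerivAt (fun y => pairing (M y) A B) (pairing (M y) (p * A) B
      + pairing (M y) A (q * B) - pairing (M y) A 1 * pairing (M y) 1 B) y :=
    fun y hy A B => hasDerivAt_pairing_x H.add_ne_zero (hdet y hy) A B
  -- This removes each power of `q` in front of `b`, so the derivatives of `v` stay polynomial in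
  -- the few pairings named below.
  have hqb : q * b = 1 - a • b := by
    ext i
    have h1 : q i + Complex.I * α ≠ 0 := fun h => (H.q_ne i).2 (eq_neg_of_add_eq_zero_left h)
    simp only [hb, pole, ha, Pi.mul_apply, Pi.sub_apply, Pi.one_apply, Pi.smul_apply, smul_eq_mul]
    field_simp
    ring
  have hq3b : q ^ 3 * b = q ^ 2 - a • q + a ^ 2 • 1 - a ^ 3 • b := by
    rw [show q ^ 3 * b = q ^ 2 * (q * b) by ring, hqb]
    have h2 : q ^ 2 * b = q * (q * b) := by ring
    rw [mul_sub, mul_smul_comm, h2, hqb, mul_sub, mul_smul_comm, hqb]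
    ext i
    simp
    ring
  have e1 : ∀ y, pairing (M y) 1 q = pairing (M y) p 1 :=
    fun y => (H.pairing_p_one y t id).symm
  have e2 : ∀ y, pairing (M y) 1 (q ^ 2) = pairing (M y) (p ^ 2) 1 := fun y => by
    have h2 := H.pairing_p_one y t fun z => z ^ 2
    have h3 : ∀ f : Fin N → ℂ, (fun z : ℂ => z ^ 2) ∘ f = f ^ 2 := fun f => by ext i; simp
    rw [h3, h3] at h2
    exact h2.symm
  set S : ℝ → ℂ := fun y => pairing (M y) 1 1 with hS
  set c₁ : ℝ → ℂ := fun y => pairing (M y) p 1 with hc₁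
  set c₂ : ℝ → ℂ := fun y => pairing (M y) (p ^ 2) 1 with hc₂
  set c₁₁ : ℝ → ℂ := fun y => pairing (M y) p q with hc₁₁
  set n₁ : ℝ → ℂ := fun y => pairing (M y) p b with hn₁
  set n₂ : ℝ → ℂ := fun y => pairing (M y) (p ^ 2) b with hn₂
  set n₃ : ℝ → ℂ := fun y => pairing (M y) (p ^ 3) b with hn₃
  have hφ : ∀ y, pairing (M y) 1 b = 1 - v y := fun y => by simp [hv, amplitude, hM, hb]
  have dS : ∀ y ∈ U, HasDerivAt S (2 * c₁ y - S y ^ 2) y := fun y hy =>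
    (hX y hy 1 1).congr_deriv (by simp only [mul_one, e1, hS, hc₁]; ring)
  have dc₁ : ∀ y ∈ U, HasDerivAt c₁ (c₂ y + c₁₁ y - c₁ y * S y) y := fun y hy =>
    (hX y hy p 1).congr_deriv (by simp only [mul_one, ← pow_two, hS, hc₁, hc₂, hc₁₁])
  have dv : ∀ y ∈ U, HasDerivAt v (-n₁ y - S y * v y + a * (1 - v y)) y := fun y hy =>
    ((hX y hy 1 b).const_sub 1).congr_deriv (by
      simp only [mul_one, hqb, pairing_sub_right, pairing_smul_right, hφ, hS, hn₁]; ring)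
  have dn₁ : ∀ y ∈ U, HasDerivAt n₁ (n₂ y + c₁ y * v y - a * n₁ y) y := fun y hy =>
    (hX y hy p b).congr_deriv (by
      simp only [← pow_two, hqb, pairing_sub_right, pairing_smul_right, hφ, hn₁, hn₂, hc₁]; ring)
  have dn₂ : ∀ y ∈ U, HasDerivAt n₂ (n₃ y + c₂ y * v y - a * n₂ y) y := fun y hy =>
    (hX y hy (p ^ 2) b).congr_deriv (by
      simp only [← pow_succ', hqb, pairing_sub_right, pairing_smul_right, hφ, hn₃, hn₂, hc₂]; ring)
  set v₁ : ℝ → ℂ := fun y => -n₁ y - S y * v y + a * (1 - v y) with hv₁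
  set v₂ : ℝ → ℂ := fun y => -(n₂ y + c₁ y * v y - a * n₁ y)
    - ((2 * c₁ y - S y ^ 2) * v y + S y * v₁ y) - a * v₁ y with hv₂
  have dv₁ : ∀ y ∈ U, HasDerivAt v₁ (v₂ y) y := fun y hy =>
    (((dn₁ y hy).neg.sub ((dS y hy).mul (dv y hy))).add
      (((dv y hy).const_sub 1).const_mul a)).congr_deriv (by simp only [hv₂]; ring)
  set v₃ : ℝ → ℂ := fun y => -(n₃ y + c₂ y * v y - a * n₂ y
      + ((c₂ y + c₁₁ y - c₁ y * S y) * v y + c₁ y * v₁ y) - a * (n₂ y + c₁ y * v y - a * n₁ y))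
    - ((2 * (c₂ y + c₁₁ y - c₁ y * S y) - 2 * S y * (2 * c₁ y - S y ^ 2)) * v y
      + (2 * c₁ y - S y ^ 2) * v₁ y + ((2 * c₁ y - S y ^ 2) * v₁ y + S y * v₂ y))
    - a * v₂ y with hv₃
  have dv₂ : ∀ y ∈ U, HasDerivAt v₂ (v₃ y) y := fun y hy =>
    (((((dn₂ y hy).add ((dc₁ y hy).mul (dv y hy))).sub ((dn₁ y hy).const_mul a)).neg.sub
      (((((dc₁ y hy).const_mul 2).sub ((dS y hy).pow 2)).mul (dv y hy)).add
        ((dS y hy).mul (dv₁ y hy)))).sub ((dv₁ y hy).const_mul a)).congr_deriv (by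
      simp only [hv₃, hv₁, Pi.sub_apply, Pi.pow_apply]
      ring)
  refine ⟨v₁, v₂, v₃, dv, dv₁, dv₂, fun y hy => ?_⟩
  have hconj : ∀ y, conj (v y) = 1 - pairing (M y) 1 (pole (-α) q) := fun y => by
    simp only [hv, amplitude, map_sub, map_one, H.conj_pairing_pole, hM]
  have r1 : ∀ y ∈ U, 2 * c₁ y - S y ^ 2 = 2 * μ * (1 - v y * conj (v y)) := fun y hy => by
    rw [hconj]
    exact H.two_mul_pairing_p_one (hdet y hy)
  have dconj : HasDerivAt (fun y => conj (v y)) (conj (v₁ y)) y :=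
    (Complex.conjCLE : ℂ →L[ℝ] ℂ).hasFDerivAt.comp_hasDerivAt y (dv y hy)
  -- The `x`-derivative of `r1`, legitimate because `r1` holds on the whole open set `U`.
  have r2 : 2 * (c₂ y + c₁₁ y - c₁ y * S y) - 2 * S y * (2 * c₁ y - S y ^ 2)
      = -(2 * μ * (v₁ y * conj (v y) + v y * conj (v₁ y))) := by
    have g1 := ((dc₁ y hy).const_mul 2).sub ((dS y hy).pow 2)
    have g2 := (((dv y hy).mul dconj).const_sub 1).const_mul (2 * μ)
    have g3 := (g2.congr_of_eventuallyEq (Filter.eventually_of_mem (hU.mem_nhds hy) r1)).unique g1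
    simp at g3
    linear_combination -g3
  have hT := (hasDerivAt_pairing_t H.add_ne_zero (hdet y hy) 1 b).const_sub 1
  refine hT.congr_deriv ?_
  change -(pairing (M y) _ _ + pairing (M y) _ _ - (pairing (M y) _ _ * pairing (M y) _ _
    - pairing (M y) _ _ * pairing (M y) _ _ + pairing (M y) _ _ * pairing (M y) _ _)
    - 6 * μ * (pairing (M y) _ _ + pairing (M y) _ _ - pairing (M y) _ _ * pairing (M y) _ _)) = _
  rw [hq3b, hqb]
  simp only [mul_one, pairing_sub_right, pairing_add_right, pairing_smul_right, hφ, e1, e2]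
  change -(n₃ y + (c₂ y - a * c₁ y + a ^ 2 * S y - a ^ 3 * (1 - v y))
    - (S y * n₂ y - c₁ y * n₁ y + c₂ y * (1 - v y))
    - 6 * μ * (n₁ y + (S y - a * (1 - v y)) - S y * (1 - v y))) = _
  have r1y := r1 y hy
  generalize conj (v y) = w at *
  generalize conj (v₁ y) = w₁ at *
  simp only [hv₂, hv₁] at r2 ⊢
  -- The coefficient of `r1` is `3 (v_x + a v)`: `r1` replaces `S_x` and `r2` replaces `S_xx` in the
  -- linear equation.
  linear_combination (3 * (-n₁ y - S y * v y + a * (1 - v y) + a * v y)) * r1y + 3 / 2 * v y * r2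

lemma darkSoliton_eq (H : Admissible h ε α ρ p q d ξ₀) {x t : ℝ}
    (hdet : (solitonMatrix ε ρ p q d ξ₀ x t).det ≠ 0) :
    darkSoliton ε α ρ p q d ξ₀ x t = ρ * (amplitude ε α ρ p q d ξ₀ x t * Complex.exp (Complex.I *
      ((α : ℂ) * x - ((α : ℂ) ^ 3 + 6 * (ε : ℂ) * (α : ℂ) * (ρ : ℂ) ^ 2) * (t : ℂ)))) := by
  rw [darkSoliton, tau_one_zero H.add_ne_zero (fun i => (H.q_ne i).2) hdet, amplitude, mul_assoc]

end Soliton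

end SasaSatsuma

end

/-! ### From the amplitude back to `u` -/

open SasaSatsuma in
theorem theorem6p1 (N : ℕ) (hN : 1 ≤ N) (h : ℕ) (hh : h ≤ N / 2) (ε α ρ : ℝ)
    (p q : Fin N → ℂ) (d ξ₀ : Fin N → ℝ)
    (hpar : SasaSatsuma.Admissible h ε α ρ p q d ξ₀) :
    SasaSatsuma.IsSolutionOn ε
      {z : ℝ × ℝ | SasaSatsuma.tau ε α ρ p q d ξ₀ 0 0 z.1 z.2 ≠ 0}
      (SasaSatsuma.darkSoliton ε α ρ p q d ξ₀) := by
  have hopen : IsOpen {z : ℝ × ℝ | tau ε α ρ p q d ξ₀ 0 0 z.1 z.2 ≠ 0} :=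
    isOpen_ne_fun (contDiff_tau 0 0).continuous continuous_const
  refine ⟨hopen, ?_, fun x t hxt => ?_⟩
  · have h1 : ContDiff ℝ ∞ fun z : ℝ × ℝ => (z.1 : ℂ) :=
      Complex.ofRealCLM.contDiff.comp contDiff_fst
    have h2 : ContDiff ℝ ∞ fun z : ℝ × ℝ => (z.2 : ℂ) :=
      Complex.ofRealCLM.contDiff.comp contDiff_snd
    have hdiv : ContDiffOn ℝ ∞ (fun z : ℝ × ℝ =>
        tau ε α ρ p q d ξ₀ 1 0 z.1 z.2 / tau ε α ρ p q d ξ₀ 0 0 z.1 z.2)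
        {z : ℝ × ℝ | tau ε α ρ p q d ξ₀ 0 0 z.1 z.2 ≠ 0} := by
        simp only [div_eq_mul_inv]
        exact (contDiff_tau 1 0).contDiffOn.mul
          (ContDiffOn.inv (contDiff_tau 0 0).contDiffOn fun z hz => hz)
    refine (contDiffOn_const.mul hdiv).mul (ContDiff.contDiffOn ?_)
    fun_prop
  set U : Set ℝ := {y | tau ε α ρ p q d ξ₀ 0 0 y t ≠ 0} with hUdef
  have hU : IsOpen U := hopen.preimage (by fun_prop : Continuous fun y : ℝ => (y, t))
  have hdet : ∀ y ∈ U, (solitonMatrix ε ρ p q d ξ₀ y t).det ≠ 0 := fun y hy => by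
    rw [← tau_zero_zero (α := α)]; exact hy
  have hx : x ∈ U := hxt
  obtain ⟨v₁, v₂, v₃, hv, hv₁, hv₂, hvt⟩ := hpar.amplitude_hasDerivAt t hU hdet
  set a : ℂ := Complex.I * α with ha
  set v : ℝ → ℂ := fun y => amplitude ε α ρ p q d ξ₀ y t with hvdef
  let E : ℝ → ℝ → ℂ := fun x t => Complex.exp (Complex.I *
      ((α : ℂ) * x - ((α : ℂ) ^ 3 + 6 * (ε : ℂ) * (α : ℂ) * (ρ : ℂ) ^ 2) * (t : ℂ)))
  have hEx : ∀ y, HasDerivAt (fun y => E y t) (a * E y t) y := fun y => by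
    have h0 : HasDerivAt (fun y : ℝ => (y : ℂ)) 1 y := Complex.ofRealCLM.hasDerivAt
    refine (((h0.const_mul (α : ℂ)).sub_const _).const_mul Complex.I).cexp.congr_deriv ?_
    simp only [E, ha]
    ring
  have hEt : HasDerivAt (fun s => E x s) ((a ^ 3 - 6 * (ε * (ρ : ℂ) ^ 2) * a) * E x t) t := by
    have h0 : HasDerivAt (fun y : ℝ => (y : ℂ)) 1 t := Complex.ofRealCLM.hasDerivAt
    refine (((h0.const_mul ((α : ℂ) ^ 3 + 6 * (ε : ℂ) * (α : ℂ) * (ρ : ℂ) ^ 2)).const_sub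
      ((α : ℂ) * x)).const_mul Complex.I).cexp.congr_deriv ?_
    have hI : Complex.I ^ 3 = -Complex.I := Complex.I_pow_three
    simp only [E, ha, mul_pow, hI]
    ring
  -- Carrying the plane wave along turns `∂_x` into `∂_x + a`, so three uses produce `(∂_x + a)³ v`.
  have hgauge : ∀ {f f' : ℝ → ℂ}, (∀ y ∈ U, HasDerivAt f (f' y) y) →
      ∀ y ∈ U, HasDerivAt (fun y => ρ * (f y * E y t)) (ρ * ((f' y + a * f y) * E y t)) y :=
    fun hf y hy => (((hf y hy).mul (hEx y)).const_mul (ρ : ℂ)).congr_deriv (by ring)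
  have hu : ∀ y ∈ U, darkSoliton ε α ρ p q d ξ₀ y t = ρ * (v y * E y t) :=
    fun y hy => darkSoliton_eq hpar (hdet y hy)
  have d₁ : ∀ y ∈ U, HasDerivAt (fun y => darkSoliton ε α ρ p q d ξ₀ y t)
      (ρ * ((v₁ y + a * v y) * E y t)) y := fun y hy =>
    (hgauge hv y hy).congr_of_eventuallyEq (Filter.eventually_of_mem (hU.mem_nhds hy) hu)
  have e₁ : ∀ y ∈ U, HasDerivAt (fun y => v₁ y + a * v y) (v₂ y + a * v₁ y) y :=
    fun y hy => (hv₁ y hy).add ((hv y hy).const_mul a)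
  have e₂ : ∀ y ∈ U, HasDerivAt (fun y => (v₂ y + a * v₁ y) + a * (v₁ y + a * v y))
      ((v₃ y + a * v₂ y) + a * (v₂ y + a * v₁ y)) y :=
    fun y hy => ((hv₂ y hy).add ((hv₁ y hy).const_mul a)).add ((e₁ y hy).const_mul a)
  rw [iteratedDeriv_three_of_hasDerivAt hU d₁ (hgauge e₁) (hgauge e₂) hx, (d₁ x hx).deriv]
  have dt : HasDerivAt (fun s => darkSoliton ε α ρ p q d ξ₀ x s) _ t :=
    (((hvt x hx).mul hEt).const_mul (ρ : ℂ)).congr_of_eventuallyEq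
      (Filter.eventually_of_mem ((hopen.preimage
        (by fun_prop : Continuous fun s : ℝ => (x, s))).mem_nhds hxt)
        fun s hs => darkSoliton_eq hpar (by rw [← tau_zero_zero (α := α)]; exact hs))
  have hE : ∀ y, ‖E y t‖ = 1 := fun y => by
    have hreal : E y t = Complex.exp (((α * y - (α ^ 3 + 6 * ε * α * ρ ^ 2) * t : ℝ) : ℂ)
        * Complex.I) := by
      simp only [E]; push_cast; ring_nf
    rw [hreal, Complex.norm_exp_ofReal_mul_I]
  have hnorm : ∀ y ∈ U, ‖darkSoliton ε α ρ p q d ξ₀ y t‖ ^ 2 = ρ ^ 2 * ‖v y‖ ^ 2 :=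
    fun y hy => by
      rw [hu y hy, norm_mul, norm_mul, hE, mul_one, mul_pow, Complex.norm_real, Real.norm_eq_abs,
        sq_abs]
  have hsq : ∀ z : ℂ, ((‖z‖ ^ 2 : ℝ) : ℂ) = z * conj z := fun z => by
    rw [Complex.mul_conj, Complex.normSq_eq_norm_sq]
  have dn : HasDerivAt (fun y => ‖darkSoliton ε α ρ p q d ξ₀ y t‖ ^ 2)
      (ρ ^ 2 * (2 * inner ℝ (v x) (v₁ x))) x :=
    ((hv x hx).norm_sq.const_mul (ρ ^ 2)).congr_of_eventuallyEq
      (Filter.eventually_of_mem (hU.mem_nhds hx) hnorm)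
  have hinner : ((2 * inner ℝ (v x) (v₁ x) : ℝ) : ℂ) = v₁ x * conj (v x) + v x * conj (v₁ x) := by
    have hre := Complex.add_conj (v₁ x * conj (v x))
    rw [map_mul, Complex.conj_conj] at hre
    rw [Complex.inner, ← hre]
    ring
  rw [dt.deriv, dn.deriv, hnorm x hx, hu x hx, Complex.ofReal_mul, Complex.ofReal_mul (ρ ^ 2) (2 * _),
    hinner, hsq, Complex.ofReal_pow]
  change (ρ : ℂ) * (_ * E x t + v x * _) = _
  ring
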